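/- Let $\mathcal{X}$ be a finite set and let $\mathcal{C}$ be a concept class over $\mathcal{X}$, i.e. a set of subsets of $\mathcal{X}$ (called concepts). A labelled example $(x,\ell)\in\mathcal{X}\times\{0,1\}$ is consistent with a concept $C$ if $\ell=1$ exactly when $x\in C$, and a set of labelled examples is consistent with $C$ if all its elements are. A teacher mapping for $\mathcal{C}$ is a map $T$ assigning to each $C\in\mathcal{C}$ a finite set $T(C)\subseteq\mathcal{X}\times\{0,1\}$ consistent with $C$; it is non-clashing if there are no two distinct $C,C'\in\mathcal{C}$ such that $T(C)$ is consistent with $C'$ and $T(C')$ is consistent with $C$. The no-clash teaching dimension $\mathrm{NCTD}(\mathcal{C})$ is the minimum, over all non-clashing teacher mappings $T$ for $\mathcal{C}$, of $\sup_{C\in\mathcal{C}}|T(C)|$ (with $\sup\emptyset=0$). Let $d=\mathrm{VCD}(\mathcal{C})$ be the VC-dimension of $\mathcal{C}$ (with the convention $\mathrm{VCD}(\emptyset)=0$). Then $\mathrm{NCTD}(\mathcal{C})$ is bounded by a quadratic function of $d$, namely \[ \mathrm{NCTD}(\mathcal{C})\;\le\;39.3752\cdot d^2-3.6330\cdot d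 . \] -/

import Mathlib

namespace Teaching

variable {X : Type*}

/-- A sample set `S` of labelled examples `(x, l)` (label `true` means "positive", i.e. `l = 1`) is
consistent with the concept `C ⊆ X` if `C(x) = l` for every `(x, l) ∈ S`. -/
def Consistent (S : Finset (X × Bool)) (C : Finset X) : Prop :=
  ∀ p ∈ S, (p.2 = true ↔ p.1 ∈ C)

/-- `T` is a teacher mapping for the concept class `𝒞`: it assigns to every `C ∈ 𝒞` a finite sample
set consistent with `C`. Values of `T` outside `𝒞` are irrelevant in all definitions below. -/
def IsTeacherMapping (𝒞 : Finset (Finset X)) (T : Finset X → Finset (X × Bool)) : Prop :=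
  ∀ C ∈ 𝒞, Consistent (T C) C

/-- `T` is non-clashing on `𝒞`: there are no two distinct `C, C' ∈ 𝒞` such that both `T C` is
consistent with `C'` and `T C'` is consistent with `C`. -/
def NonClashing (𝒞 : Finset (Finset X)) (T : Finset X → Finset (X × Bool)) : Prop :=
  ∀ C ∈ 𝒞, ∀ C' ∈ 𝒞, C ≠ C' → ¬ (Consistent (T C) C' ∧ Consistent (T C') C)

/-- The order of `T` on `𝒞`: the largest size of a sample set `T C` with `C ∈ 𝒞`
(`0` if `𝒞` is empty). -/
def order (T : Finset X → Finset (X × Bool)) (𝒞 : Finset (Finset X)) : ℕ :=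
  𝒞.sup fun C => (T C).card

/-- The no-clash teaching dimension of `𝒞`: the least order of a non-clashing teacher mapping
for `𝒞`. -/
noncomputable def NCTD (𝒞 : Finset (Finset X)) : ℕ :=
  sInf {k | ∃ T : Finset X → Finset (X × Bool),
    IsTeacherMapping 𝒞 T ∧ NonClashing 𝒞 T ∧ order T 𝒞 = k}

/-- Over a finite domain a non-clashing teacher mapping exists (present all labels), so that the
infimum in the definition of `NCTD` is over a nonempty set of natural numbers, i.e. a minimum. -/
theorem exists_nonClashing [Fintype X] [DecidableEq X] (𝒞 : Finset (Finset X)) :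
    ∃ T : Finset X → Finset (X × Bool), IsTeacherMapping 𝒞 T ∧ NonClashing 𝒞 T := by
  refine ⟨fun C => Finset.univ.image fun x => (x, decide (x ∈ C)), ?_, ?_⟩
  · intro C _ p hp
    obtain ⟨x, -, rfl⟩ := Finset.mem_image.1 hp
    simp
  · intro C _ C' _ hne h
    apply hne
    ext x
    have := h.1 (x, decide (x ∈ C)) (Finset.mem_image.2 ⟨x, Finset.mem_univ x, rfl⟩)
    simpa using this

/-- The minimum in the definition of `NCTD` is attained. -/
theorem NCTD_attained [Fintype X] [DecidableEq X] (𝒞 : Finset (Finset X)) :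
    ∃ T : Finset X → Finset (X × Bool),
      IsTeacherMapping 𝒞 T ∧ NonClashing 𝒞 T ∧ order T 𝒞 = NCTD 𝒞 := by
  obtain ⟨T, hT, hN⟩ := exists_nonClashing 𝒞
  exact Nat.sInf_mem (s := {k | ∃ T : Finset X → Finset (X × Bool),
    IsTeacherMapping 𝒞 T ∧ NonClashing 𝒞 T ∧ order T 𝒞 = k}) ⟨_, T, hT, hN, rfl⟩

end Teaching

/-!
The argument bounds the teaching number of a single concept in every subclass, and teaches the
class greedily. Write `α = 16 / 9` and call a class *sparse at level* `n` if every set of at most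
`n` points has at most `α ^ n` traces of concepts (`TraceSparse`).

* A class which is sparse at level `1` has at most one concept.
* If a class is sparse at level `j + 2`, then prescribing the labels of `⌊9 j / 2⌋ + 1` points
  suitably leaves a nonempty subclass which is sparse at level `j + 1`
  (`TraceSparse.exists_agreeing`). The labelled points are chosen so that the number of remaining
  concepts is minimal; if the remaining class had too many traces on a set `Z`, then a double count
  would give a trace on `Z` which by itself forces at least `|Z|` of the prescribed labels, and
  prescribing this trace in place of those labels would leave fewer concepts.
* Hence a nonempty class which is sparse at level `j + 1` has a concept which is determined by
  about `9 j ^ 2 / 4` labels (`TraceSparse.exists_teachable`). Removing such concepts one after the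
  other gives a non-clashing teacher mapping (`nctd_le_of_forall_subset`).
* By the Sauer-Shelah lemma, a class of VC dimension `d ≥ 1` has at most
  `∑ i ≤ d, (4 d).choose i ≤ (256 / 27) ^ d ≤ α ^ (4 d)` traces on a set of at most `4 d` points, so
  it is sparse at level `4 d` (`traceSparse_four_mul_vcDim`).

The last two points give the bound `36 d ^ 2 - 23 d + 7 / 2` for `d ≥ 1`.
-/

namespace Teaching

variable {X : Type*} [DecidableEq X]

/-! ### Traces and agreement -/

/-- The traces of the concepts of `𝒞` on the set of points `A`. -/
def traces (𝒞 : Finset (Finset X)) (A : Finset X) : Finset (Finset X) :=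
  𝒞.image (· ∩ A)

/-- The concepts of `𝒞` which give the points of `Y` the same labels as `C` does. -/
def agreeing (𝒞 : Finset (Finset X)) (C Y : Finset X) : Finset (Finset X) :=
  𝒞.filter fun D => D ∩ Y = C ∩ Y

/-- Every set of at most `n` points has at most `(16 / 9) ^ n` traces of concepts of `𝒞`. The
exponent is `n` and not the number of points, so that small domains need no special treatment. -/
def TraceSparse (𝒞 : Finset (Finset X)) (n : ℕ) : Prop :=
  ∀ A : Finset X, A.card ≤ n → 9 ^ n * (traces 𝒞 A).card ≤ 16 ^ n

/-- Some concept of `𝒞` is determined within `𝒞` by its labels on at most `k` points. -/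
def Teachable (𝒞 : Finset (Finset X)) (k : ℕ) : Prop :=
  ∃ C ∈ 𝒞, ∃ Y : Finset X, Y.card ≤ k ∧ ∀ D ∈ 𝒞, D ∩ Y = C ∩ Y → D = C

theorem inter_eq_inter_iff {A B Y : Finset X} :
    A ∩ Y = B ∩ Y ↔ ∀ x ∈ Y, (x ∈ A ↔ x ∈ B) := by
  simp only [Finset.ext_iff, Finset.mem_inter]
  exact ⟨fun h x hx => by simpa [hx] using h x, fun h x => by
    by_cases hx : x ∈ Y <;> simp [hx, h x]⟩

theorem mem_agreeing {𝒞 : Finset (Finset X)} {C Y D : Finset X} :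
    D ∈ agreeing 𝒞 C Y ↔ D ∈ 𝒞 ∧ ∀ x ∈ Y, (x ∈ D ↔ x ∈ C) := by
  simp [agreeing, inter_eq_inter_iff]

theorem traces_mono {𝒞 𝒟 : Finset (Finset X)} (h : 𝒟 ⊆ 𝒞) (A : Finset X) :
    traces 𝒟 A ⊆ traces 𝒞 A :=
  Finset.image_subset_image h

theorem TraceSparse.mono {𝒞 𝒟 : Finset (Finset X)} {n : ℕ} (h : TraceSparse 𝒞 n) (h𝒟 : 𝒟 ⊆ 𝒞) :
    TraceSparse 𝒟 n := fun A hA =>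
  (Nat.mul_le_mul_left _ (Finset.card_le_card (traces_mono h𝒟 A))).trans (h A hA)

/-- Splitting a class by the label of `w` splits its traces on `insert w Z`, and restricting the
traces of either part further to `Z` does not increase their number. -/
theorem card_traces_add_card_traces_le (𝒞 : Finset (Finset X)) (Z : Finset X) (w : X)
    (p : Prop) [Decidable p] :
    (traces (𝒞.filter fun D => (w ∈ D ↔ p)) Z).card +
      (traces (𝒞.filter fun D => ¬(w ∈ D ↔ p)) Z).card ≤ (traces 𝒞 (insert w Z)).card := by
  have hle : ∀ 𝒟 : Finset (Finset X),
      (traces 𝒟 Z).card ≤ (traces 𝒟 (insert w Z)).card := by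
    intro 𝒟
    have : traces 𝒟 Z = (traces 𝒟 (insert w Z)).image (· ∩ Z) := by
      unfold traces
      rw [Finset.image_image]
      refine Finset.image_congr fun D _ => ?_
      simp [Finset.inter_assoc, Finset.inter_eq_right.2 (Finset.subset_insert w Z)]
    rw [this]
    exact Finset.card_image_le
  refine (add_le_add (hle _) (hle _)).trans ?_
  rw [← Finset.card_union_of_disjoint]
  · exact Finset.card_le_card (Finset.union_subset
      (traces_mono (Finset.filter_subset _ _) _) (traces_mono (Finset.filter_subset _ _) _))
  · rw [Finset.disjoint_left]
    simp only [traces, Finset.mem_image, Finset.mem_filter, not_exists, not_and]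
    rintro _ ⟨D, ⟨_, hD⟩, rfl⟩ E ⟨_, hE⟩ hED
    have := inter_eq_inter_iff.1 hED w (Finset.mem_insert_self _ _)
    tauto

/-! ### Lowering the level of sparsity -/

/-- If the concepts agreeing with `C` on `Y` have more than `(16 / 9) ^ n` traces on `Z`, then for
each `w ∈ Y` at least two ninths of these traces force the label of `w` in the whole class. -/
theorem TraceSparse.card_forcing {𝒞 : Finset (Finset X)} {n : ℕ} (h : TraceSparse 𝒞 (n + 1))
    {C Y Z : Finset X} (hZ : Z.card ≤ n)
    (hN : 16 ^ n < 9 ^ n * (traces (agreeing 𝒞 C Y) Z).card) {w : X} (hw : w ∈ Y) :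
    2 * (traces (agreeing 𝒞 C Y) Z).card ≤
      9 * ((traces (agreeing 𝒞 C Y) Z).filter
        fun t => ∀ D ∈ 𝒞, D ∩ Z = t → (w ∈ D ↔ w ∈ C)).card := by
  set P := traces (agreeing 𝒞 C Y) Z with hP
  have h1 : P ⊆ traces (𝒞.filter fun D => (w ∈ D ↔ w ∈ C)) Z := by
    refine traces_mono (fun D hD => ?_) Z
    rw [mem_agreeing] at hD
    exact Finset.mem_filter.2 ⟨hD.1, hD.2 w hw⟩
  have h2 : P.filter (fun t => ¬ ∀ D ∈ 𝒞, D ∩ Z = t → (w ∈ D ↔ w ∈ C)) ⊆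
      traces (𝒞.filter fun D => ¬(w ∈ D ↔ w ∈ C)) Z := by
    intro t ht
    obtain ⟨D, hD, hDt, hDw⟩ : ∃ D ∈ 𝒞, D ∩ Z = t ∧ ¬(w ∈ D ↔ w ∈ C) := by
      simpa using (Finset.mem_filter.1 ht).2
    exact Finset.mem_image.2 ⟨D, Finset.mem_filter.2 ⟨hD, hDw⟩, hDt⟩
  have h3 := card_traces_add_card_traces_le 𝒞 Z w (w ∈ C)
  have h4 := h (insert w Z) ((Finset.card_insert_le _ _).trans (by omega))
  have h5 := Finset.card_filter_add_card_filter_not (s := P)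
    (fun t => ∀ D ∈ 𝒞, D ∩ Z = t → (w ∈ D ↔ w ∈ C))
  have h6 := Finset.card_le_card h1
  have h7 := Finset.card_le_card h2
  have h8 : 9 * (traces 𝒞 (insert w Z)).card < 16 * P.card := by
    refine Nat.lt_of_mul_lt_mul_left (a := 9 ^ n) ?_
    rw [pow_succ, pow_succ] at h4
    linarith
  omega

/-- In a class sparse at level `j + 2`, the labels of `k > 9 j / 2` points can be prescribed so that
the remaining class is nonempty and sparse at level `j + 1`. -/
theorem TraceSparse.exists_agreeing {𝒞 : Finset (Finset X)} {j k : ℕ}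
    (h : TraceSparse 𝒞 (j + 2)) (hne : 𝒞.Nonempty) (hk : 9 * j < 2 * k) :
    ∃ C ∈ 𝒞, ∃ Y : Finset X, Y.card ≤ k ∧ TraceSparse (agreeing 𝒞 C Y) (j + 1) := by
  -- `Y` and `C` are chosen such that as few concepts as possible agree with `C` on `Y`.
  obtain ⟨m, ⟨C, hC, Y, hY, rfl⟩, hmin⟩ : ∃ m,
      (∃ C ∈ 𝒞, ∃ Y : Finset X, Y.card ≤ k ∧ (agreeing 𝒞 C Y).card = m) ∧
      ∀ C ∈ 𝒞, ∀ Y : Finset X, Y.card ≤ k → m ≤ (agreeing 𝒞 C Y).card := by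
    classical
    obtain ⟨C, hC⟩ := hne
    have hex : ∃ m, ∃ C ∈ 𝒞, ∃ Y : Finset X, Y.card ≤ k ∧ (agreeing 𝒞 C Y).card = m :=
      ⟨_, C, hC, ∅, by simp, rfl⟩
    exact ⟨Nat.find hex, Nat.find_spec hex, fun D hD Y hY => Nat.find_min' hex ⟨D, hD, Y, hY, rfl⟩⟩
  refine ⟨C, hC, Y, hY, fun Z hZ => ?_⟩
  by_contra! hN
  set P := traces (agreeing 𝒞 C Y) Z with hP
  have hP2 : 1 < P.card := by
    by_contra! hle
    have h1 : 9 ^ (j + 1) * P.card ≤ 16 ^ (j + 1) :=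
      (Nat.mul_le_mul_left _ hle).trans
        (by rw [mul_one]; exact Nat.pow_le_pow_left (by norm_num) _)
    omega
  have hCmem : C ∈ agreeing 𝒞 C Y := mem_agreeing.2 ⟨hC, fun _ _ => Iff.rfl⟩
  -- By minimality, all `k` points are used.
  have hYk : Y.card = k := by
    by_contra hYk
    obtain ⟨t, ht, hne⟩ := Finset.exists_mem_ne hP2 (C ∩ Z)
    obtain ⟨D, hD, rfl⟩ := Finset.mem_image.1 ht
    obtain ⟨z, hz⟩ : ∃ z, ¬(z ∈ D ↔ z ∈ C) := by
      by_contra! hall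
      exact hne (congrArg (· ∩ Z) (Finset.ext hall))
    refine absurd (hmin C hC (insert z Y) ((Finset.card_insert_le _ _).trans (by omega)))
      (not_le.2 (Finset.card_lt_card ?_))
    refine Finset.ssubset_iff_of_subset (fun E hE => ?_) |>.2 ⟨D, hD, fun hD' => ?_⟩
    · rw [mem_agreeing] at hE ⊢
      exact ⟨hE.1, fun x hx => hE.2 x (Finset.mem_insert_of_mem hx)⟩
    · exact hz ((mem_agreeing.1 hD').2 z (Finset.mem_insert_self _ _))
  -- Double counting the pairs of a trace and a label forced by it.
  obtain ⟨t, ht, htW⟩ : ∃ t ∈ P,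
      j + 1 ≤ (Y.filter fun w => ∀ D ∈ 𝒞, D ∩ Z = t → (w ∈ D ↔ w ∈ C)).card := by
    by_contra! hall
    have hcount := Finset.sum_card_bipartiteAbove_eq_sum_card_bipartiteBelow (s := Y) (t := P)
      fun w t => ∀ D ∈ 𝒞, D ∩ Z = t → (w ∈ D ↔ w ∈ C)
    simp only [Finset.bipartiteAbove, Finset.bipartiteBelow] at hcount
    have h1 := Finset.sum_le_card_nsmul P _ j fun t ht => Nat.lt_succ_iff.1 (hall t ht)
    have h2 := Finset.card_nsmul_le_sum Y _ (2 * P.card) fun w hw => h.card_forcing hZ hN hw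
    rw [← Finset.mul_sum, hcount, hYk, smul_eq_mul] at h2
    rw [smul_eq_mul] at h1
    have h3 : P.card * (2 * k) ≤ P.card * (9 * j) := by linarith
    have h4 := Nat.le_of_mul_le_mul_left h3 (by omega)
    omega
  set W := Y.filter fun w => ∀ D ∈ 𝒞, D ∩ Z = t → (w ∈ D ↔ w ∈ C) with hW
  have hWY : (Y \ W).card + W.card = Y.card :=
    Finset.card_sdiff_add_card_eq_card (Finset.filter_subset _ _)
  obtain ⟨D, hD, rfl⟩ := Finset.mem_image.1 ht
  obtain ⟨t', ht', hne'⟩ := Finset.exists_mem_ne hP2 (D ∩ Z)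
  obtain ⟨D', hD', rfl⟩ := Finset.mem_image.1 ht'
  have hcard : ((Y \ W) ∪ Z).card ≤ k := by
    have h1 := Finset.card_union_le (Y \ W) Z
    omega
  -- Prescribing the trace of `D` on `Z` in place of the labels on `W` leaves fewer concepts.
  refine absurd (hmin D (mem_agreeing.1 hD).1 _ hcard) (not_le.2 (Finset.card_lt_card ?_))
  refine Finset.ssubset_iff_of_subset (fun E hE => ?_) |>.2 ⟨D', hD', fun hD'' => hne' ?_⟩
  · rw [mem_agreeing] at hE ⊢
    refine ⟨hE.1, fun w hw => ?_⟩
    by_cases hwW : w ∈ W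
    · exact (Finset.mem_filter.1 hwW).2 E hE.1
        (inter_eq_inter_iff.2 fun x hx => hE.2 x (Finset.mem_union_right _ hx))
    · exact (hE.2 w (Finset.mem_union_left _ (Finset.mem_sdiff.2 ⟨hw, hwW⟩))).trans
        ((mem_agreeing.1 hD).2 w hw)
  · exact inter_eq_inter_iff.2 fun x hx =>
      (mem_agreeing.1 hD'').2 x (Finset.mem_union_right _ hx)

/-- The number of labels used to descend from level `j + 1` to level `1`. -/
def labelBudget (j : ℕ) : ℕ :=
  ∑ i ∈ Finset.range j, (9 * i / 2 + 1)

theorem TraceSparse.exists_teachable {𝒞 : Finset (Finset X)} {j : ℕ}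
    (h : TraceSparse 𝒞 (j + 1)) (hne : 𝒞.Nonempty) : Teachable 𝒞 (labelBudget j) := by
  induction j generalizing 𝒞 with
  | zero =>
    obtain ⟨C, hC⟩ := hne
    refine ⟨C, hC, ∅, by simp, fun D hD _ => ?_⟩
    ext x
    have h1 := h {x} (by simp)
    have h2 : (traces 𝒞 {x}).card ≤ 1 := by omega
    have h3 := Finset.card_le_one.1 h2 _ (Finset.mem_image_of_mem _ hD) _
      (Finset.mem_image_of_mem _ hC)
    exact inter_eq_inter_iff.1 h3 x (by simp)
  | succ j ih =>
    obtain ⟨C, hC, Y, hY, hs⟩ := h.exists_agreeing (k := 9 * j / 2 + 1) hne (by omega)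
    obtain ⟨D, hD, Y', hY', hdet⟩ := ih hs ⟨C, mem_agreeing.2 ⟨hC, fun _ _ => Iff.rfl⟩⟩
    rw [mem_agreeing] at hD
    refine ⟨D, hD.1, Y' ∪ Y, (Finset.card_union_le _ _).trans ?_, fun E hE hED => ?_⟩
    · rw [labelBudget, Finset.sum_range_succ]
      exact add_le_add hY' hY
    · rw [inter_eq_inter_iff] at hED
      refine hdet E (mem_agreeing.2 ⟨hE, fun x hx => ?_⟩) (inter_eq_inter_iff.2 fun x hx => ?_)
      · exact (hED x (Finset.mem_union_right _ hx)).trans (hD.2 x hx)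
      · exact hED x (Finset.mem_union_left _ hx)

theorem labelBudget_le (j : ℕ) : (labelBudget j : ℝ) ≤ 9 / 4 * (j * (j - 1)) + j := by
  induction j with
  | zero => simp [labelBudget]
  | succ j ih =>
    rw [labelBudget, Finset.sum_range_succ, ← labelBudget]
    have h1 : ((9 * j / 2 : ℕ) : ℝ) ≤ (9 * j : ℕ) / 2 := by exact_mod_cast Nat.cast_div_le
    push_cast at h1 ⊢
    linarith

/-! ### Greedy teaching -/

theorem consistent_image_iff {Y C D : Finset X} :
    Consistent (Y.image fun x => (x, decide (x ∈ C))) D ↔ D ∩ Y = C ∩ Y := by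
  simp only [Consistent, Finset.forall_mem_image, decide_eq_true_eq, inter_eq_inter_iff]
  exact forall₂_congr fun x _ => Iff.comm

/-- A concept taught by a set of labels that determines it clashes with no other concept, whatever
the sets assigned to the other concepts are; hence concepts can be taught one after the other. -/
theorem exists_nonClashing_of_forall_subset {𝒞 : Finset (Finset X)} {k : ℕ}
    (h : ∀ 𝒟 ⊆ 𝒞, 𝒟.Nonempty → Teachable 𝒟 k) :
    ∃ T : Finset X → Finset (X × Bool),
      IsTeacherMapping 𝒞 T ∧ NonClashing 𝒞 T ∧ ∀ C ∈ 𝒞, (T C).card ≤ k := by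
  induction hn : 𝒞.card generalizing 𝒞 with
  | zero =>
    obtain rfl := Finset.card_eq_zero.1 hn
    exact ⟨fun _ => ∅, by simp [IsTeacherMapping], by simp [NonClashing], by simp⟩
  | succ n ih =>
    obtain ⟨C, hC, Y, hY, hdet⟩ := h 𝒞 subset_rfl (Finset.card_pos.1 (by omega))
    obtain ⟨T, hT, hNC, hcard⟩ := ih (𝒞 := 𝒞.erase C)
      (fun 𝒟 h𝒟 => h 𝒟 (h𝒟.trans (Finset.erase_subset _ _)))
      (by rw [Finset.card_erase_of_mem hC, hn]; rfl)
    refine ⟨Function.update T C (Y.image fun x => (x, decide (x ∈ C))), ?_, ?_, ?_⟩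
    · intro D hD
      rcases eq_or_ne D C with rfl | hDC
      · rw [Function.update_self, consistent_image_iff]
      · rw [Function.update_of_ne hDC]
        exact hT D (Finset.mem_erase.2 ⟨hDC, hD⟩)
    · rintro D hD E hE hDE ⟨h1, h2⟩
      rcases eq_or_ne D C with rfl | hDC
      · rw [Function.update_self, consistent_image_iff] at h1
        exact hDE (hdet E hE h1).symm
      · rcases eq_or_ne E C with rfl | hEC
        · rw [Function.update_self, consistent_image_iff] at h2
          exact hDE (hdet D hD h2)
        · rw [Function.update_of_ne hDC] at h1
          rw [Function.update_of_ne hEC] at h2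
          exact hNC D (Finset.mem_erase.2 ⟨hDC, hD⟩) E (Finset.mem_erase.2 ⟨hEC, hE⟩) hDE ⟨h1, h2⟩
    · intro D hD
      rcases eq_or_ne D C with rfl | hDC
      · rw [Function.update_self]
        exact Finset.card_image_le.trans hY
      · rw [Function.update_of_ne hDC]
        exact hcard D (Finset.mem_erase.2 ⟨hDC, hD⟩)

theorem nctd_le_of_forall_subset {𝒞 : Finset (Finset X)} {k : ℕ}
    (h : ∀ 𝒟 ⊆ 𝒞, 𝒟.Nonempty → Teachable 𝒟 k) : NCTD 𝒞 ≤ k := by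
  obtain ⟨T, hT, hNC, hcard⟩ := exists_nonClashing_of_forall_subset h
  have hle : NCTD 𝒞 ≤ order T 𝒞 := Nat.sInf_le ⟨T, hT, hNC, rfl⟩
  exact hle.trans (Finset.sup_le hcard)

theorem TraceSparse.nctd_le {𝒞 : Finset (Finset X)} {j : ℕ} (h : TraceSparse 𝒞 (j + 1)) :
    NCTD 𝒞 ≤ labelBudget j :=
  nctd_le_of_forall_subset fun _ h𝒟 hne => (h.mono h𝒟).exists_teachable hne

/-! ### Sparsity from the VC dimension -/

theorem shatters_of_shatters_traces {𝒞 : Finset (Finset X)} {A s : Finset X}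
    (h : (traces 𝒞 A).Shatters s) : s ⊆ A ∧ 𝒞.Shatters s := by
  have hsA : s ⊆ A := by
    obtain ⟨u, hu, hsu⟩ := h.exists_superset
    obtain ⟨D, -, rfl⟩ := Finset.mem_image.1 hu
    exact hsu.trans Finset.inter_subset_right
  refine ⟨hsA, fun t ht => ?_⟩
  obtain ⟨u, hu, rfl⟩ := h ht
  obtain ⟨D, hD, rfl⟩ := Finset.mem_image.1 hu
  refine ⟨D, hD, ?_⟩
  rw [← Finset.inter_assoc, Finset.inter_right_comm, Finset.inter_eq_left.2 hsA]

/-- The Sauer-Shelah bound for the traces on a set of points. -/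
theorem card_traces_le_sum_choose (𝒞 : Finset (Finset X)) (A : Finset X) :
    (traces 𝒞 A).card ≤ ∑ i ∈ Finset.range (𝒞.vcDim + 1), A.card.choose i := by
  have hsub : (traces 𝒞 A).shatterer ⊆
      (Finset.range (𝒞.vcDim + 1)).biUnion fun i => A.powersetCard i := by
    intro s hs
    obtain ⟨hsA, hs'⟩ := shatters_of_shatters_traces (Finset.mem_shatterer.1 hs)
    exact Finset.mem_biUnion.2 ⟨s.card, Finset.mem_range.2 (Nat.lt_succ_of_le hs'.card_le_vcDim),
      Finset.mem_powersetCard.2 ⟨hsA, rfl⟩⟩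
  calc (traces 𝒞 A).card ≤ (traces 𝒞 A).shatterer.card := Finset.card_le_card_shatterer _
    _ ≤ _ := Finset.card_le_card hsub
    _ ≤ ∑ i ∈ Finset.range (𝒞.vcDim + 1), (A.powersetCard i).card := Finset.card_biUnion_le
    _ = _ := by simp only [Finset.card_powersetCard]

/-- Compare with the expansion of `(1 + 3) ^ (4 * d)`. -/
theorem pow_mul_sum_choose_le (d : ℕ) :
    27 ^ d * ∑ i ∈ Finset.range (d + 1), (4 * d).choose i ≤ 256 ^ d := by
  calc 27 ^ d * ∑ i ∈ Finset.range (d + 1), (4 * d).choose i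
      = ∑ i ∈ Finset.range (d + 1), 3 ^ (3 * d) * (4 * d).choose i := by
        rw [Finset.mul_sum, pow_mul]; norm_num
    _ ≤ ∑ i ∈ Finset.range (d + 1), 1 ^ i * 3 ^ (4 * d - i) * (4 * d).choose i := by
        refine Finset.sum_le_sum fun i hi => Nat.mul_le_mul_right _ ?_
        have := Finset.mem_range.1 hi
        rw [one_pow, one_mul]
        exact Nat.pow_le_pow_right (by norm_num) (by omega)
    _ ≤ ∑ i ∈ Finset.range (4 * d + 1), 1 ^ i * 3 ^ (4 * d - i) * (4 * d).choose i :=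
        Finset.sum_le_sum_of_subset (Finset.range_subset_range.2 (by omega))
    _ = 256 ^ d := by
        have h := add_pow 1 3 (4 * d)
        simp only [Nat.cast_id] at h
        rw [← h, pow_mul]; norm_num

theorem traceSparse_four_mul_vcDim (𝒞 : Finset (Finset X)) : TraceSparse 𝒞 (4 * 𝒞.vcDim) := by
  intro A hA
  set d := 𝒞.vcDim
  have h1 : (traces 𝒞 A).card ≤ ∑ i ∈ Finset.range (d + 1), (4 * d).choose i :=
    (card_traces_le_sum_choose 𝒞 A).trans
      (Finset.sum_le_sum fun i _ => Nat.choose_le_choose i hA)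
  have h2 := (Nat.mul_le_mul_left (27 ^ d) h1).trans (pow_mul_sum_choose_le d)
  calc 9 ^ (4 * d) * (traces 𝒞 A).card = 243 ^ d * (27 ^ d * (traces 𝒞 A).card) := by
        rw [← mul_assoc, ← mul_pow, pow_mul]; norm_num
    _ ≤ 243 ^ d * 256 ^ d := Nat.mul_le_mul_left _ h2
    _ ≤ 256 ^ d * 256 ^ d := Nat.mul_le_mul_right _ (Nat.pow_le_pow_left (by norm_num) _)
    _ = 16 ^ (4 * d) := by rw [← mul_pow, pow_mul]; norm_num

theorem traceSparse_one_of_vcDim_eq_zero {𝒞 : Finset (Finset X)} (h : 𝒞.vcDim = 0) :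
    TraceSparse 𝒞 1 := by
  intro A _
  have := card_traces_le_sum_choose 𝒞 A
  rw [h] at this
  simp at this
  omega

end Teaching

theorem mainTheorem11 {X : Type*} [Fintype X] [DecidableEq X] (𝒞 : Finset (Finset X)) :
    (Teaching.NCTD 𝒞 : ℝ) ≤ 39.3752 * (𝒞.vcDim : ℝ) ^ 2 - 3.6330 * (𝒞.vcDim : ℝ) := by
  obtain hd | hd := Nat.eq_zero_or_pos 𝒞.vcDim
  · have h : Teaching.NCTD 𝒞 = 0 :=
      Nat.le_zero.1 (Teaching.traceSparse_one_of_vcDim_eq_zero hd).nctd_le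
    simp [h, hd]
  · obtain ⟨d, hd'⟩ := Nat.exists_eq_add_of_le' hd
    have h1 := Teaching.traceSparse_four_mul_vcDim 𝒞
    rw [hd', show 4 * (d + 1) = (4 * d + 3) + 1 by ring] at h1
    have h2 : (Teaching.NCTD 𝒞 : ℝ) ≤ Teaching.labelBudget (4 * d + 3) := by
      exact_mod_cast h1.nctd_le
    have h3 := Teaching.labelBudget_le (4 * d + 3)
    rw [hd']
    push_cast at h3 ⊢
    nlinarith [sq_nonneg (d : ℝ), Nat.cast_nonneg (α := ℝ) d]
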